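/- All topoi are Grothendieck topoi, and $\mathrm{Set}$ is the category of small sets. A point $p$ of a topos $\mathcal{E}$ is a geometric morphism $p:\mathrm{Set}\to\mathcal{E}$, and a morphism of points $p\to p'$ is a natural transformation $p^*\Rightarrow p'^*$. A topos has enough points if the inverse image functors of all its points jointly reflect isomorphisms. Given a point $p$ of $\mathcal{E}$, an object $Z$ of $\mathcal{E}$, elements $x\neq y$ of $p^*(Z)$, a morphism $m:S\to T$ in $\mathcal{E}$ and an element $w\in p^*(T)$, an improvement of $p$ with respect to $(x,y,m,w)$ consists of a point $p'$ of $\mathcal{E}$, a natural transformation $n:p^*\Rightarrow p'^*$ and an element $v\in p'^*(S)$ such that $p'^*(m)(v)=n_T(w)$ and $n_Z(x)\neq n_Z(y)$. **Theorem.** Let $j:\mathcal{F}\rightarrowtail\mathcal{E}$ be an inclusion of topoi, that is, a geometric morphism whose direct image functor $j_*$ is full and faithful. Call a monomorphism $m$ of $\mathcal{E}$ $j$-dense if $j_*j^*(m)$ is an isomorphism. Suppose that for every point $p$ of $\mathcal{E}$, every object $X$ of $\mathcal{F}$, all elements $x\neq y$ of $p^*(j_*X)$, every $j$-dense monomorphism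 $m:S\rightarrowtail T$ of $\mathcal{E}$ and every $w\in p^*(T)$, there exists an improvement of $p$ with respect to $(x,y,m,w)$. Then, assuming Zorn's lemma, if $\mathcal{E}$ has enough points, so does $\mathcal{F}$. -/

import Mathlib

open CategoryTheory Limits

universe w v₁ v₂ u₁ u₂

/-- A category is a (Grothendieck) topos, relative to the universe `w` of small sets, if it is
equivalent to the category of sheaves of `w`-small sets on a `w`-small site. -/
class IsGrothendieckTopos (E : Type u₁) [Category.{v₁} E] : Prop where
  exists_site : ∃ (C : Type w) (_ : SmallCategory C) (J : GrothendieckTopology C),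
    Nonempty (E ≌ Sheaf J (Type w))

/-- A geometric morphism `f : F → E`: a direct image functor `f_* : F ⥤ E` together with a left
adjoint `f^* : E ⥤ F` preserving finite limits. -/
structure GeometricMorphism (F : Type u₁) [Category.{v₁} F] (E : Type u₂) [Category.{v₂} E] where
  /-- the direct image functor `f_*` -/
  direct : F ⥤ E
  /-- the inverse image functor `f^*` -/
  inverse : E ⥤ F
  /-- the adjunction `f^* ⊣ f_*` -/
  adj : inverse ⊣ direct
  preservesFiniteLimits : PreservesFiniteLimits inverse

namespace GeometricMorphism

variable {F : Type u₁} [Category.{v₁} F] {E : Type u₂} [Category.{v₂} E]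

/-- A geometric morphism is an inclusion if its direct image functor is full and faithful. -/
structure IsInclusion (j : GeometricMorphism F E) : Prop where
  full : j.direct.Full
  faithful : j.direct.Faithful

/-- A monomorphism `m` of `E` is `j`-dense if `j_* j^* m` is an isomorphism. -/
structure IsDense (j : GeometricMorphism F E) {S T : E} (m : S ⟶ T) : Prop where
  mono : Mono m
  isIso : IsIso (j.direct.map (j.inverse.map m))

end GeometricMorphism

/-- A point of a topos `E` is a geometric morphism from the category of sets to `E`. -/
abbrev ToposPoint (E : Type u₁) [Category.{v₁} E] : Type _ :=
  GeometricMorphism (Type w) E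

/-- A topos has enough points if the inverse image functors of all its points jointly
reflect isomorphisms. -/
def HasEnoughToposPoints (E : Type u₁) [Category.{v₁} E] : Prop :=
  ∀ ⦃X Y : E⦄ (f : X ⟶ Y),
    (∀ p : ToposPoint.{w} E, IsIso (p.inverse.map f)) → IsIso f

/-- An improvement of the point `p` with respect to the data `(x, y, m, w)`, where
`x, y ∈ p^*(Z)`, `m : S ⟶ T` and `w ∈ p^*(T)`: a point `p'`, a morphism of points `p ⟶ p'`
(that is, a natural transformation `n : p^* ⟶ p'^*`), and an element `v ∈ p'^*(S)`
such that `p'^*(m)(v) = n_T(w)` and `n_Z(x) ≠ n_Z(y)`. -/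
structure Improvement {E : Type u₁} [Category.{v₁} E] (p : ToposPoint.{w} E) {Z : E}
    (x y : p.inverse.obj Z) {S T : E} (m : S ⟶ T) (w : p.inverse.obj T) where
  /-- the improved point `p'` -/
  point : ToposPoint.{w} E
  /-- the morphism of points -/
  n : p.inverse ⟶ point.inverse
  /-- the lift of `w` along `m` at the improved point -/
  v : point.inverse.obj S
  lift : point.inverse.map m v = n.app T w
  separates : n.app Z x ≠ n.app Z y

/-!
Every pair of distinct elements of `p^* (j_* X)`, for `p` a point of `E`, stays distinct along some
morphism from `p` to a point that factors through `j`
(`exists_restricted_point_separating`). It follows that the points of `F` are jointly faithful: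
parallel maps of `F` with distinct direct images are distinguished by a point `p` of `E`, which has
enough points, and hence by a point of `F`. A morphism inverted by all points of `F` is then both
mono and epi, and a topos is balanced.

The point that factors through `j` is obtained by improving `p` repeatedly. Filtered colimits of
inverse image functors are again inverse image functors
(`isClosedUnderColimitsOfShape_inverseImageFunctors`), and they preserve the separation of two
elements. A transfinite iteration of improvements therefore lifts, along a small family of dense
monomorphisms, all elements present in `p` (`exists_separatingExtension_lifting`), and repeating
this countably often makes every member of the family surjective
(`exists_separatingExtension_surjective`).

For the small family one takes the dense subobjects of a small separating family of `E`. By pulling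
back, the resulting functor `q` then sends all dense monomorphisms to surjections
(`surjective_map_of_isDense`). Applied to diagonals and images this shows that `q` inverts all
morphisms inverted by `j^*` (`isIso_map_of_isIso_inverse_map`), in particular the units
`A ⟶ j_* j^* A`, which is what is needed for a point to factor through `j` (`restrictPoint`).
-/

/-! ### Transfinite saturation in a category -/

section Saturation

open SmallObject in
/-- Let each object `d` carry a subset `s d` of a small set `W`, growing along morphisms. If any
given element of `W` can be captured after some morphism out of any given object, then all
elements can be captured simultaneously. Here an uncaptured element is captured at each successor
step of a transfinite iteration, which therefore becomes saturated at some stage of any chain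
longer than the cardinality of `W`. -/
theorem exists_hom_forall_mem_of_progress {D : Type u₁} [Category.{v₁} D]
    (hD : ∀ (J : Type w) [LinearOrder J] [Nonempty J], HasColimitsOfShape J D)
    {W : Type w} (s : D → Set W) (hs : ∀ ⦃d d' : D⦄, (d ⟶ d') → s d ⊆ s d')
    (progress : ∀ (d : D) (a : W), ∃ (d' : D) (_ : d ⟶ d'), a ∈ s d') (d : D) :
    ∃ (d' : D) (_ : d ⟶ d'), ∀ a, a ∈ s d' := by
  classical
  by_contra! hd
  choose g hg hga using progress
  let Φ : SuccStruct D :=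
    { X₀ := d
      succ := fun e => if h : ∃ a, a ∉ s e then g e h.choose else e
      toSucc := fun e => if h : ∃ a, a ∉ s e then hg e h.choose ≫ eqToHom (by rw [dif_pos h])
        else eqToHom (by rw [dif_neg h]) }
  let κ : Cardinal.{w} := Order.succ (max (Cardinal.mk W) Cardinal.aleph0)
  have hκ : Cardinal.aleph0 ≤ κ := (le_max_right _ _).trans (Order.le_succ _)
  have : NoMaxOrder κ.ord.ToType := Cardinal.noMaxOrder hκ
  have : Nonempty κ.ord.ToType := Ordinal.nonempty_toType_iff.2 (by
    simpa using (Cardinal.aleph0_pos.trans_le hκ).ne')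
  let : OrderBot κ.ord.ToType := WellFoundedLT.toOrderBot _
  have : HasIterationOfShape κ.ord.ToType D :=
    { hasColimitsOfShape_of_isSuccLimit := fun j hj => by
        have := hj.nonempty_Iio.to_subtype
        exact hD _
      hasColimitsOfShape := hD _ }
  let F := Φ.iterationFunctor κ.ord.ToType
  -- If no stage were saturated, choosing an element newly captured at each successor stage would
  -- inject `κ.ord.ToType` into `W`.
  have hF (j) : ∃ a, a ∉ s (F.obj j) := hd _ ((Φ.ιIterationFunctor κ.ord.ToType).app j)
  have key (j : κ.ord.ToType) : ∃ a, a ∉ s (F.obj j) ∧ a ∈ s (F.obj (Order.succ j)) := by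
    refine ⟨(hF j).choose, (hF j).choose_spec, ?_⟩
    apply hs (Φ.iterationFunctorObjSuccIso j (not_isMax j)).inv
    have : Φ.succ (F.obj j) = g (F.obj j) (hF j).choose := dif_pos (hF j)
    rw [this]
    exact hga _ _
  choose a ha ha' using key
  have hlt {i j} (hij : i < j) : a i ∈ s (F.obj j) :=
    hs (F.map (homOfLE (Order.succ_le_of_lt hij))) (ha' i)
  have hinj : Function.Injective a := by
    intro i j hij
    rcases lt_trichotomy i j with h | h | h
    · exact absurd (hij ▸ hlt h) (ha j)
    · exact h
    · exact absurd (hij ▸ hlt h) (ha i)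
  have := Cardinal.mk_le_of_injective hinj
  rw [Cardinal.mk_ord_toType] at this
  exact absurd this (not_le.2 ((le_max_left _ _).trans_lt (Order.lt_succ _)))

end Saturation

/-! ### Colimits of left adjoints -/

section ColimitAdjoint

variable {E : Type u₁} [Category.{v₁} E] {T : Type u₂} [Category.{v₂} T]

/-- The bijection on morphisms of an adjunction turns precomposition with `α : L₂ ⟶ L₁` into
postcomposition with the conjugate `R₁ ⟶ R₂` of `α`. -/
theorem CategoryTheory.Adjunction.homEquiv_conjugateEquiv {L₁ L₂ : E ⥤ T} {R₁ R₂ : T ⥤ E} (adj₁ : L₁ ⊣ R₁)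
    (adj₂ : L₂ ⊣ R₂) (α : L₂ ⟶ L₁) {A : E} {S : T} (f : L₁.obj A ⟶ S) :
    adj₂.homEquiv A S (α.app A ≫ f) =
      adj₁.homEquiv A S f ≫ (conjugateEquiv adj₁ adj₂ α).app S := by
  apply (adj₂.homEquiv A S).symm.injective
  rw [Equiv.symm_apply_apply, Adjunction.homEquiv_counit, Functor.map_comp, Category.assoc,
    conjugateEquiv_counit, ← Category.assoc, α.naturality, Category.assoc,
    ← Adjunction.homEquiv_counit, Equiv.symm_apply_apply]

variable {J : Type*} [Category* J]

/-- A pointwise colimit of left adjoints is a left adjoint: its right adjoint is the limit of the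
right adjoints along the conjugate transition maps. -/
theorem isLeftAdjoint_of_isColimit [HasLimitsOfShape Jᵒᵖ E] {K : J ⥤ E ⥤ T}
    (hK : ∀ j, (K.obj j).IsLeftAdjoint) {c : Cocone K}
    (hc : ∀ A, IsColimit (((evaluation E T).obj A).mapCocone c)) : c.pt.IsLeftAdjoint := by
  let adj (j) := Adjunction.ofIsLeftAdjoint (K.obj j)
  let R (S : T) : Jᵒᵖ ⥤ E :=
    { obj := fun j => (K.obj j.unop).rightAdjoint.obj S
      map := fun f => (conjugateEquiv (adj _) (adj _) (K.map f.unop)).app S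
      map_id := fun j => by simp
      map_comp := fun f g => by
        rw [unop_comp, K.map_comp, ← conjugateEquiv_comp _ (adj _), NatTrans.comp_app] }
  have e (A : E) (S : T) : ∃ φ : (c.pt.obj A ⟶ S) ≃ (A ⟶ limit (R S)),
      ∀ f j, φ f ≫ limit.π (R S) j = (adj j.unop).homEquiv A S ((c.ι.app j.unop).app A ≫ f) := by
    let toHom (f : c.pt.obj A ⟶ S) : A ⟶ limit (R S) := limit.lift (R S)
      { pt := A
        π :=
          { app := fun j => (adj j.unop).homEquiv A S ((c.ι.app j.unop).app A ≫ f)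
            naturality := fun i j u => by
              dsimp [R]
              rw [Category.id_comp, ← Adjunction.homEquiv_conjugateEquiv, ← Category.assoc,
                ← NatTrans.comp_app, c.w] } }
    have toHom_π f j : toHom f ≫ limit.π (R S) j =
        (adj j.unop).homEquiv A S ((c.ι.app j.unop).app A ≫ f) := limit.lift_π _ j
    let ofHom (g : A ⟶ limit (R S)) : c.pt.obj A ⟶ S := (hc A).desc
      { pt := S
        ι :=
          { app := fun j => ((adj j).homEquiv A S).symm (g ≫ limit.π (R S) (.op j))
            naturality := fun i j u => by
              apply ((adj i).homEquiv A S).injective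
              dsimp
              rw [Category.comp_id, Equiv.apply_symm_apply, Adjunction.homEquiv_conjugateEquiv (adj j),
                Equiv.apply_symm_apply, Category.assoc]
              exact congrArg (g ≫ ·) (limit.w (R S) u.op) } }
    have ι_ofHom g j : (c.ι.app j).app A ≫ ofHom g =
        ((adj j).homEquiv A S).symm (g ≫ limit.π (R S) (.op j)) := (hc A).fac _ j
    refine ⟨⟨toHom, ofHom, fun f => ?_, fun g => ?_⟩, toHom_π⟩
    · refine (hc A).hom_ext fun j => ?_
      refine (ι_ofHom _ j).trans ?_
      rw [toHom_π, Equiv.symm_apply_apply]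
      rfl
    · refine limit.hom_ext fun j => ?_
      rw [toHom_π, ι_ofHom, Equiv.apply_symm_apply]
  choose φ hφ using e
  refine (Adjunction.adjunctionOfEquivRight φ fun A' A S f g => ?_).isLeftAdjoint
  refine limit.hom_ext fun j => ?_
  have hn := (c.ι.app j.unop).naturality f
  dsimp at hn
  rw [hφ, Category.assoc, hφ, ← Category.assoc, ← hn, Category.assoc,
    Adjunction.homEquiv_naturality_left]

end ColimitAdjoint

/-! ### Extensions of a point separating two elements -/

section SeparatingExtensions

variable {E : Type u₁} [Category.{v₁} E]

/-- The functors `E ⥤ Type w` that are inverse images of points of `E`. -/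
def inverseImageFunctors (E : Type u₁) [Category.{v₁} E] : ObjectProperty (E ⥤ Type w) :=
  fun q => PreservesFiniteLimits q ∧ q.IsLeftAdjoint

/-- Filtered colimits of inverse image functors are inverse image functors, since filtered colimits
of sets commute with finite limits. -/
theorem isClosedUnderColimitsOfShape_inverseImageFunctors (J : Type w) [SmallCategory J]
    [IsFiltered J] [HasLimitsOfShape Jᵒᵖ E] :
    (inverseImageFunctors.{w} E).IsClosedUnderColimitsOfShape J where
  colimitsOfShape_le := by
    rintro q ⟨h⟩
    have : HasExactColimitsOfShape J (Type w) := ⟨inferInstance⟩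
    refine ⟨?_, ?_⟩
    · exact ObjectProperty.prop_of_isColimit ObjectProperty.preservesFiniteLimits
        h.isColimit fun j => (h.prop_diag_obj j).1
    · exact isLeftAdjoint_of_isColimit (fun j => (h.prop_diag_obj j).2) fun A =>
        isColimitOfPreserves ((evaluation _ _).obj A) h.isColimit

variable {q₀ : E ⥤ Type w} {Z : E}

theorem CategoryTheory.Under.right_app_hom_app {d d' : Under q₀} (f : d ⟶ d') (z : q₀.obj Z) :
    f.right.app Z (d.hom.app Z z) = d'.hom.app Z z :=
  ConcreteCategory.congr_hom (NatTrans.congr_app (Under.w f) Z) z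

variable (x y : q₀.obj Z)

/-- The morphisms from `q₀` to the inverse image functor of a point, viewed as objects of
`Under q₀`, that keep the elements `x` and `y` of `q₀.obj Z` distinct. -/
def separatingExtensions : ObjectProperty (Under q₀) :=
  fun d => inverseImageFunctors E d.right ∧ d.hom.app Z x ≠ d.hom.app Z y

theorem isClosedUnderColimitsOfShape_separatingExtensions (J : Type w) [SmallCategory J]
    [IsFiltered J] [HasLimitsOfShape Jᵒᵖ E] :
    (separatingExtensions x y).IsClosedUnderColimitsOfShape J where
  colimitsOfShape_le := by
    rintro d ⟨h⟩
    have := IsFiltered.isConnected J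
    have := isClosedUnderColimitsOfShape_inverseImageFunctors (E := E) J
    have hr := isColimitOfPreserves (Under.forget q₀) h.isColimit
    refine ⟨ObjectProperty.prop_of_isColimit _ hr fun j => (h.prop_diag_obj j).1, fun heq => ?_⟩
    have hZ := isColimitOfPreserves ((evaluation _ _).obj Z) hr
    obtain ⟨j⟩ : Nonempty J := inferInstance
    obtain ⟨k, f, hk⟩ := (Types.FilteredColimit.isColimit_eq_iff' hZ
      ((h.diag.obj j).hom.app Z x) ((h.diag.obj j).hom.app Z y)).1
      ((Under.right_app_hom_app (h.ι.app j) x).trans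
        (heq.trans (Under.right_app_hom_app (h.ι.app j) y).symm))
    apply (h.prop_diag_obj k).2
    rw [← Under.right_app_hom_app (h.diag.map f) x, ← Under.right_app_hom_app (h.diag.map f) y]
    exact hk

theorem hasColimitsOfShape_separatingExtensions (J : Type w) [SmallCategory J] [IsFiltered J]
    [HasLimitsOfShape Jᵒᵖ E] :
    HasColimitsOfShape J (separatingExtensions x y).FullSubcategory := by
  have := IsFiltered.isConnected J
  have := isClosedUnderColimitsOfShape_separatingExtensions x y J
  exact hasColimitsOfShape_of_closedUnderColimits _ _

end SeparatingExtensions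

/-! ### Extensions making a small family of morphisms surjective -/

section SurjectiveExtension

variable {E : Type u₁} [Category.{v₁} E] [HasLimitsOfSize.{w, w} E] {Z : E}
  {ι : Type w} {S T : ι → E} (m : ∀ i, S i ⟶ T i)

include m in
/-- If every point can be improved with respect to each single element of its values at the `T i`,
then one extension of `q` lifts all elements of all `q.obj (T i)` at once. Only elements coming
from `q` are lifted, not the new elements of the extension. -/
theorem exists_separatingExtension_lifting
    (improve : ∀ (q : E ⥤ Type w), inverseImageFunctors E q → ∀ x y : q.obj Z, x ≠ y →
      ∀ (i : ι) (t : q.obj (T i)), ∃ (q' : E ⥤ Type w) (n : q ⟶ q') (v : q'.obj (S i)),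
        inverseImageFunctors E q' ∧ q'.map (m i) v = n.app _ t ∧ n.app Z x ≠ n.app Z y)
    {q : E ⥤ Type w} (hq : inverseImageFunctors E q) {x y : q.obj Z} (hxy : x ≠ y) :
    ∃ (q' : E ⥤ Type w) (n : q ⟶ q'), inverseImageFunctors E q' ∧ n.app Z x ≠ n.app Z y ∧
      ∀ (i : ι) (t : q.obj (T i)), ∃ v, q'.map (m i) v = n.app _ t := by
  let s (d : (separatingExtensions x y).FullSubcategory) : Set (Σ i, q.obj (T i)) :=
    {a | ∃ v, d.obj.right.map (m a.1) v = d.obj.hom.app _ a.2}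
  obtain ⟨d, -, hd⟩ := exists_hom_forall_mem_of_progress
    (D := (separatingExtensions x y).FullSubcategory) (fun J _ _ =>
      hasColimitsOfShape_separatingExtensions x y J) s
    (by
      rintro d d' f a ⟨v, hv⟩
      refine ⟨f.hom.right.app _ v, ?_⟩
      rw [← NatTrans.naturality_apply, hv]
      exact Under.right_app_hom_app f.hom a.2)
    (by
      rintro d ⟨i, t⟩
      obtain ⟨q', n, v, hq', hv, hn⟩ := improve _ d.property.1 _ _ d.property.2 i
        (d.obj.hom.app _ t)
      exact ⟨⟨Under.mk (d.obj.hom ≫ n), hq', hn⟩, ⟨Under.homMk n⟩, v, hv⟩)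
    ⟨Under.mk (𝟙 q), hq, hxy⟩
  exact ⟨d.obj.right, d.obj.hom, d.property.1, d.property.2, fun i t => hd ⟨i, t⟩⟩

include m in
/-- The colimit of a sequence of extensions, each lifting all elements present at the previous
stage, makes every `m i` surjective. -/
theorem exists_separatingExtension_surjective
    (improve : ∀ (q : E ⥤ Type w), inverseImageFunctors E q → ∀ x y : q.obj Z, x ≠ y →
      ∀ (i : ι) (t : q.obj (T i)), ∃ (q' : E ⥤ Type w) (n : q ⟶ q') (v : q'.obj (S i)),
        inverseImageFunctors E q' ∧ q'.map (m i) v = n.app _ t ∧ n.app Z x ≠ n.app Z y)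
    {q : E ⥤ Type w} (hq : inverseImageFunctors E q) {x y : q.obj Z} (hxy : x ≠ y) :
    ∃ (q' : E ⥤ Type w) (n : q ⟶ q'), inverseImageFunctors E q' ∧ n.app Z x ≠ n.app Z y ∧
      ∀ i, Function.Surjective (q'.map (m i)) := by
  let D := (separatingExtensions x y).FullSubcategory
  have step (d : D) : ∃ (d' : D) (f : d ⟶ d'), ∀ (i : ι) (t : d.obj.right.obj (T i)),
      ∃ v, d'.obj.right.map (m i) v = f.hom.right.app _ t := by
    obtain ⟨q', n, hq', hn, hv⟩ := exists_separatingExtension_lifting m improve d.property.1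
      d.property.2
    exact ⟨⟨Under.mk (d.obj.hom ≫ n), hq', hn⟩, ⟨Under.homMk n⟩, hv⟩
  choose g f hf using step
  let d (k : ℕ) : D := Nat.rec ⟨Under.mk (𝟙 q), hq, hxy⟩ (fun _ e => g e) k
  let F : ℕ ⥤ D := Functor.ofSequence (X := d) fun k => f (d k)
  have : (separatingExtensions x y).IsClosedUnderColimitsOfShape ℕ :=
    have := isClosedUnderColimitsOfShape_separatingExtensions x y (ULift.{w} ℕ)
    .of_equivalence (ULift.orderIso.{w} (α := ℕ)).equivalence
  have := IsFiltered.isConnected ℕ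
  have : HasColimitsOfShape ℕ D := hasColimitsOfShape_of_closedUnderColimits _ _
  refine ⟨(colimit F).obj.right, (colimit F).obj.hom, (colimit F).property.1,
    (colimit F).property.2, fun i t => ?_⟩
  have hc := isColimitOfPreserves ((evaluation _ _).obj (T i))
    (isColimitOfPreserves (Under.forget q) (isColimitOfPreserves
      (separatingExtensions x y).ι (colimit.isColimit F)))
  obtain ⟨k, t, rfl⟩ := Types.jointly_surjective_of_isColimit hc t
  obtain ⟨v, hv⟩ := hf (d k) i t
  refine ⟨(colimit.ι F (k + 1)).hom.right.app _ v, ?_⟩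
  have hw : f (d k) ≫ colimit.ι F (k + 1) = colimit.ι F k := by
    rw [← colimit.w F (homOfLE (Nat.le_add_right k 1)), Functor.ofSequence_map_homOfLE_succ]
    rfl
  refine (NatTrans.naturality_apply (colimit.ι F (k + 1)).hom.right (m i) v).symm.trans ?_
  refine (congrArg _ hv).trans ?_
  exact ConcreteCategory.congr_hom (congrArg (fun φ : d k ⟶ colimit F => φ.hom.right.app (T i)) hw) t

end SurjectiveExtension

/-! ### Categorical properties of Grothendieck topoi -/

section ToposFacts

variable (E : Type u₁) [Category.{v₁} E] [IsGrothendieckTopos.{w} E]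

namespace IsGrothendieckTopos

theorem hasLimitsOfSize : HasLimitsOfSize.{w, w} E := by
  obtain ⟨C, _, J, ⟨e⟩⟩ := exists_site.{w} (E := E)
  exact Adjunction.has_limits_of_equivalence e.functor

theorem hasFiniteLimits : HasFiniteLimits E :=
  have := hasLimitsOfSize.{w} E
  hasFiniteLimits_of_hasLimitsOfSize.{w, w} E

theorem balanced : Balanced E := by
  obtain ⟨C, _, J, ⟨e⟩⟩ := exists_site.{w} (E := E)
  refine ⟨fun f _ _ => ?_⟩
  have : IsIso (e.functor.map f) := isIso_of_mono_of_epi _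
  exact isIso_of_reflects_iso f e.functor

theorem locallySmall : LocallySmall.{w} E := by
  obtain ⟨C, _, J, ⟨e⟩⟩ := exists_site.{w} (E := E)
  exact (locallySmall_congr e).2 inferInstance

/-- The sheafified representables of a small site form a small separating family. -/
theorem exists_isSeparating :
    ∃ (ι : Type w) (G : ι → E), (ObjectProperty.ofObj G).IsSeparating := by
  obtain ⟨C, _, J, ⟨e⟩⟩ := exists_site.{w} (E := E)
  have hS : (ObjectProperty.ofObj fun _ : Unit => PUnit.{w + 1}).IsSeparating := by
    intro X Y f g h
    ext x
    exact ConcreteCategory.congr_hom (h _ (ObjectProperty.ofObj_apply _ ()) (↾fun _ => x)) .unit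
  refine ⟨C × Unit, fun c => e.inverse.obj (Sheaf.freeYoneda J c.1 PUnit.{w + 1}), ?_⟩
  intro X Y f g h
  apply e.functor.map_injective
  refine Sheaf.isSeparating J hS _ _ ?_
  rintro _ ⟨c⟩ a
  obtain ⟨b, rfl⟩ := (e.symm.toAdjunction.homEquiv _ _).surjective a
  have := h _ (ObjectProperty.ofObj_apply _ c) b
  simp only [Adjunction.homEquiv_unit]
  exact (by simpa using congrArg (fun k => _ ≫ e.functor.map k) this)

theorem small_subobject (X : E) : Small.{w} (Subobject X) := by
  have := hasFiniteLimits.{w} E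
  have := balanced.{w} E
  have := locallySmall.{w} E
  obtain ⟨ι, G, hG⟩ := exists_isSeparating.{w} E
  have := wellPowered_of_isDetecting.{w} hG.isDetecting
  infer_instance

theorem exists_epi_mono_factorization {X Y : E} (f : X ⟶ Y) :
    ∃ (I : E) (e : X ⟶ I) (m : I ⟶ Y), Epi e ∧ Mono m ∧ e ≫ m = f := by
  obtain ⟨C, _, J, ⟨α⟩⟩ := exists_site.{w} (E := E)
  refine ⟨α.inverse.obj (image (α.functor.map f)),
    α.unit.app X ≫ α.inverse.map (factorThruImage (α.functor.map f)),
    α.inverse.map (image.ι (α.functor.map f)) ≫ α.unitInv.app Y,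
    inferInstance, inferInstance, ?_⟩
  rw [Category.assoc, ← α.inverse.map_comp_assoc, image.fac]
  simp

end IsGrothendieckTopos

end ToposFacts

/-! ### Restricting a point along an inclusion of topoi -/

section InverseImages

variable {E : Type u₁} [Category.{v₁} E]

/-- The inverse image of any object is covered by the inverse images of the objects of a separating
family: the indicator of the covered elements and the constant map `True` have transposes that
agree on the separating family. -/
theorem exists_map_eq_of_isSeparating {ι : Type*} {G : ι → E}
    (hG : (ObjectProperty.ofObj G).IsSeparating) (q : E ⥤ Type w) [q.IsLeftAdjoint] {B : E}
    (t : q.obj B) : ∃ (i : ι) (b : G i ⟶ B) (u : q.obj (G i)), q.map b u = t := by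
  let adj := Adjunction.ofIsLeftAdjoint q
  let χ : q.obj B ⟶ ULift.{w} Prop := ↾fun z => ⟨∃ (i : ι) (b : G i ⟶ B) (u : _), q.map b u = z⟩
  let τ : q.obj B ⟶ ULift.{w} Prop := ↾fun _ => ⟨True⟩
  have h : χ = τ := by
    apply (adj.homEquiv _ _).injective
    apply hG
    rintro _ ⟨i⟩ b
    rw [← Adjunction.homEquiv_naturality_left, ← Adjunction.homEquiv_naturality_left]
    congr 1
    ext u
    exact ⟨fun _ => trivial, fun _ => ⟨i, b, u, rfl⟩⟩
  simpa [χ, τ] using ConcreteCategory.congr_hom h t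

namespace GeometricMorphism

variable {F : Type u₂} [Category.{v₂} F] (j : GeometricMorphism F E)

theorem isDense_iff (hj : j.IsInclusion) {S T : E} (m : S ⟶ T) :
    j.IsDense m ↔ Mono m ∧ IsIso (j.inverse.map m) := by
  have := hj.full
  have := hj.faithful
  refine ⟨fun h => ⟨h.mono, ?_⟩, fun ⟨h, _⟩ => ⟨h, inferInstance⟩⟩
  have := h.isIso
  exact isIso_of_reflects_iso _ j.direct

theorem isIso_inverse_map_of_isPullback {P X Y Z : E} {fst : P ⟶ X} {snd : P ⟶ Y} {f : X ⟶ Z}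
    {g : Y ⟶ Z} (h : IsPullback fst snd f g) (hf : IsIso (j.inverse.map f)) :
    IsIso (j.inverse.map snd) := by
  have := j.preservesFiniteLimits
  exact (MorphismProperty.isomorphisms F).of_isPullback (h.map j.inverse) hf

variable {j} [HasFiniteLimits E]

/-- Surjectivity on dense monomorphisms needs to be tested only on dense subobjects of the objects
of a separating family, because dense monomorphisms are stable under pullback. -/
theorem surjective_map_of_isDense (hj : j.IsInclusion) {ι : Type*} {G : ι → E}
    (hG : (ObjectProperty.ofObj G).IsSeparating) (q : E ⥤ Type w) [q.IsLeftAdjoint]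
    (hq : ∀ (i : ι) (P : Subobject (G i)), j.IsDense P.arrow →
      Function.Surjective (q.map P.arrow)) {S T : E} {m : S ⟶ T} (hm : j.IsDense m) :
    Function.Surjective (q.map m) := by
  intro t
  obtain ⟨i, b, u, rfl⟩ := exists_map_eq_of_isSeparating hG q t
  rw [isDense_iff j hj] at hm
  have := hm.1
  have hi := j.isIso_inverse_map_of_isPullback (IsPullback.of_hasPullback m b) hm.2
  let P := Subobject.mk (pullback.snd m b)
  have hP : j.IsDense P.arrow := by
    rw [isDense_iff j hj, ← Subobject.underlyingIso_hom_comp_eq_mk, Functor.map_comp]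
    exact ⟨inferInstance, inferInstance⟩
  obtain ⟨v, rfl⟩ := hq i P hP u
  refine ⟨q.map ((Subobject.underlyingIso _).hom ≫ pullback.fst m b) v, ?_⟩
  rw [← types_comp_apply, ← types_comp_apply, ← q.map_comp, ← q.map_comp, Category.assoc,
    pullback.condition, Subobject.underlyingIso_hom_comp_eq_mk_assoc]

/-- An inverse image functor that sends dense monomorphisms to surjections inverts every morphism
`f` inverted by `j^*`: both the diagonal of `f` and the inclusion of the image of `f` are dense. -/
theorem isIso_map_of_isIso_inverse_map (hj : j.IsInclusion)
    (himage : ∀ ⦃X Y : E⦄ (f : X ⟶ Y),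
      ∃ (I : E) (e : X ⟶ I) (m : I ⟶ Y), Epi e ∧ Mono m ∧ e ≫ m = f) (q : E ⥤ Type w)
    [PreservesFiniteLimits q] [q.IsLeftAdjoint]
    (hq : ∀ ⦃S T : E⦄ (m : S ⟶ T), j.IsDense m → Function.Surjective (q.map m))
    {A B : E} (f : A ⟶ B) [hf : IsIso (j.inverse.map f)] : IsIso (q.map f) := by
  have := j.preservesFiniteLimits
  rw [isIso_iff_bijective]
  constructor
  · intro a b hab
    have hfst : IsIso (j.inverse.map (pullback.fst f f)) :=
      j.isIso_inverse_map_of_isPullback (IsPullback.of_hasPullback f f).flip hf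
    have hdiag : j.IsDense (pullback.diagonal f) := by
      refine (isDense_iff j hj _).2 ⟨inferInstance, ?_⟩
      have h1 : j.inverse.map (pullback.diagonal f) ≫ j.inverse.map (pullback.fst f f) = 𝟙 _ := by
        rw [← Functor.map_comp, pullback.diagonal_fst, CategoryTheory.Functor.map_id]
      exact IsIso.of_isIso_fac_right h1
    obtain ⟨z, rfl, rfl⟩ := Types.exists_of_isPullback
      ((IsPullback.of_hasPullback f f).map q) a b hab
    obtain ⟨c, rfl⟩ := hq _ hdiag z
    rw [← types_comp_apply, ← types_comp_apply, ← q.map_comp, ← q.map_comp,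
      pullback.diagonal_fst, pullback.diagonal_snd]
  · obtain ⟨I, e, m, _, _, rfl⟩ := himage f
    have hm : j.IsDense m := by
      refine (isDense_iff j hj _).2 ⟨inferInstance, ?_⟩
      have : IsSplitEpi (j.inverse.map m) :=
        ⟨⟨inv (j.inverse.map (e ≫ m)) ≫ j.inverse.map e, by
          rw [Category.assoc, ← Functor.map_comp, IsIso.inv_hom_id]⟩⟩
      exact isIso_of_mono_of_isSplitEpi _
    rw [q.map_comp]
    exact (hq _ hm).comp ((epi_iff_surjective (q.map e)).1 inferInstance)

/-- A point `p` of `E` whose inverse image inverts the units `A ⟶ j_* j^* A` factors through the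
inclusion `j`: the factorization has inverse image `p^* j_*` and direct image `j^* p_*`. -/
noncomputable def restrictPoint (hj : j.IsInclusion) (p : ToposPoint.{w} E)
    (hp : ∀ A, IsIso (p.inverse.map (j.adj.unit.app A))) : ToposPoint.{w} F where
  direct := p.direct ⋙ j.inverse
  inverse := j.direct ⋙ p.inverse
  adj := by
    have := hj.full
    have := hj.faithful
    let : Reflective j.direct := { L := j.inverse, adj := j.adj }
    -- `p_* S` is local, as the retraction of its unit is the transpose of the map
    -- `p^* j_* j^* p_* S ≅ p^* p_* S ⟶ S`.
    have (S : Type w) : IsIso (j.adj.unit.app (p.direct.obj S)) := by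
      have : IsSplitMono (j.adj.unit.app (p.direct.obj S)) :=
        ⟨⟨p.adj.homEquiv _ _ (inv (p.inverse.map (j.adj.unit.app (p.direct.obj S))) ≫
            p.adj.counit.app S), by
          rw [← Adjunction.homEquiv_naturality_left, IsIso.hom_inv_id_assoc,
            Adjunction.homEquiv_unit]
          simp⟩⟩
      have : IsSplitMono ((reflectorAdjunction j.direct).unit.app (p.direct.obj S)) := this
      exact Functor.essImage.unit_isIso (mem_essImage_of_unit_isSplitMono (i := j.direct))
    exact p.adj.restrictFullyFaithful (.ofFullyFaithful j.direct) (.id _) (Iso.refl _)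
      (NatIso.ofComponents (fun S => asIso (j.adj.unit.app (p.direct.obj S)))
        fun f => j.adj.unit.naturality _)
  preservesFiniteLimits := by
    have := p.preservesFiniteLimits
    have := j.adj.rightAdjoint_preservesLimits
    exact comp_preservesFiniteLimits _ _

end GeometricMorphism

end InverseImages

/-! ### Enough points -/

section EnoughPoints

/-- If a topos has enough points, then they are jointly faithful, by conservativity applied to
equalizers. -/
theorem HasEnoughToposPoints.hom_ext {E : Type u₁} [Category.{v₁} E] [HasEqualizers E]
    (hE : HasEnoughToposPoints.{w} E) {A B : E} {a b : A ⟶ B}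
    (h : ∀ p : ToposPoint.{w} E, p.inverse.map a = p.inverse.map b) : a = b := by
  have : IsIso (equalizer.ι a b) := hE _ fun p => by
    have := p.preservesFiniteLimits
    exact isIso_limit_cone_parallelPair_of_eq (h p)
      (isLimitForkMapOfIsLimit p.inverse _ (equalizerIsEqualizer a b))
  exact eq_of_epi_equalizer

/-- Distinct elements of `p^* (j_* X)` remain distinct in some point of `F`. -/
theorem exists_restricted_point_separating
    {F : Type u₁} [Category.{v₁} F] {E : Type u₂} [Category.{v₂} E] [IsGrothendieckTopos.{w} E]
    (j : GeometricMorphism F E) (hj : j.IsInclusion)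
    (improve : ∀ (p : ToposPoint.{w} E) (X : F) (x y : p.inverse.obj (j.direct.obj X)),
      x ≠ y → ∀ (S T : E) (m : S ⟶ T), j.IsDense m → ∀ t : p.inverse.obj T,
        Nonempty (Improvement p x y m t))
    (p : ToposPoint.{w} E) (X : F) (x y : p.inverse.obj (j.direct.obj X)) (hxy : x ≠ y) :
    ∃ (r : ToposPoint.{w} F) (n : j.direct ⋙ p.inverse ⟶ r.inverse), n.app X x ≠ n.app X y := by
  have := IsGrothendieckTopos.hasLimitsOfSize.{w} E
  have := IsGrothendieckTopos.hasFiniteLimits.{w} E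
  have := IsGrothendieckTopos.small_subobject.{w} E
  obtain ⟨ι, G, hG⟩ := IsGrothendieckTopos.exists_isSeparating.{w} E
  let σ := equivShrink.{w} (Σ i, {P : Subobject (G i) // j.IsDense P.arrow})
  obtain ⟨q, n, hq, hn, hsurj⟩ := exists_separatingExtension_surjective
    (fun k => (σ.symm k).2.1.arrow) (q := p.inverse) (x := x) (y := y)
    (fun q hq x y hxy k t => by
      have := hq.2
      obtain ⟨⟨p', n, v, hv, hn⟩⟩ := improve ⟨_, q, .ofIsLeftAdjoint q, hq.1⟩ X x y hxy _ _ _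
        (σ.symm k).2.2 t
      exact ⟨p'.inverse, n, v, ⟨p'.preservesFiniteLimits, p'.adj.isLeftAdjoint⟩, hv, hn⟩)
    ⟨p.preservesFiniteLimits, p.adj.isLeftAdjoint⟩ hxy
  have := hq.1
  have := hq.2
  have hdense ⦃S T : E⦄ (m : S ⟶ T) (hm : j.IsDense m) : Function.Surjective (q.map m) :=
    GeometricMorphism.surjective_map_of_isDense hj hG q (fun i P hP => by
      have h := hsurj (σ ⟨i, P, hP⟩)
      rwa [σ.symm_apply_apply] at h) hm
  refine ⟨GeometricMorphism.restrictPoint hj ⟨_, q, .ofIsLeftAdjoint q, hq.1⟩ fun A => ?_,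
    Functor.whiskerLeft j.direct n, hn⟩
  have := hj.full
  have := hj.faithful
  have : IsIso (j.inverse.map (j.adj.unit.app A)) := inferInstance
  exact GeometricMorphism.isIso_map_of_isIso_inverse_map hj
    (fun _ _ f => IsGrothendieckTopos.exists_epi_mono_factorization.{w} E f) q hdense _

end EnoughPoints

theorem theorem2p7
    {F : Type u₁} [Category.{v₁} F] [IsGrothendieckTopos.{w} F]
    {E : Type u₂} [Category.{v₂} E] [IsGrothendieckTopos.{w} E]
    (j : GeometricMorphism F E) (hj : j.IsInclusion)
    (improve : ∀ (p : ToposPoint.{w} E) (X : F) (x y : p.inverse.obj (j.direct.obj X)),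
      x ≠ y → ∀ (S T : E) (m : S ⟶ T), j.IsDense m → ∀ t : p.inverse.obj T,
        Nonempty (Improvement p x y m t))
    (hE : HasEnoughToposPoints.{w} E) :
    HasEnoughToposPoints.{w} F := by
  have := IsGrothendieckTopos.hasFiniteLimits.{w} E
  have := IsGrothendieckTopos.balanced.{w} F
  have := hj.faithful
  -- The points of `F` are jointly faithful, so any `f` that they all invert is mono and epi.
  have hom_ext ⦃A B : F⦄ (a b : A ⟶ B)
      (h : ∀ r : ToposPoint.{w} F, r.inverse.map a = r.inverse.map b) : a = b := by
    apply j.direct.map_injective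
    refine hE.hom_ext fun p => ?_
    ext t
    by_contra hne
    obtain ⟨r, n, hn⟩ := exists_restricted_point_separating j hj improve p B _ _ hne
    apply hn
    have ha := NatTrans.naturality_apply n a t
    have hb := NatTrans.naturality_apply n b t
    exact ha.trans ((ConcreteCategory.congr_hom (h r) _).trans hb.symm)
  intro X Y f hf
  have : Mono f := ⟨fun a b hab => hom_ext a b fun r => by
    have := hf r
    rw [← cancel_mono (r.inverse.map f), ← Functor.map_comp, hab, Functor.map_comp]⟩
  have : Epi f := ⟨fun a b hab => hom_ext a b fun r => by
    have := hf r
    rw [← cancel_epi (r.inverse.map f), ← Functor.map_comp, hab, Functor.map_comp]⟩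
  exact isIso_of_mono_of_epi f
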